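/- Let $d\ge 1$ and $n\ge 32d$ be integers, let $\mathbb S^d=\{x\in\mathbb R^{d+1}:\|x\|_2=1\}$, and let $\pi_d$ be the uniform distribution on $\mathbb S^d$, i.e. the $d$-dimensional Hausdorff measure on $\mathbb S^d$ normalized to a probability measure. For $x\in\mathbb S^d$ and $t\in[-1,1]$ let $C(x,t)=\{y\in\mathbb S^d:\langle x,y\rangle>t\}$, let $$\mathcal S_d=\{C(x,t)\cap C(y,s): x,y\in\mathbb S^d,\ s,t\in[-1,1]\}$$ be the family of spherical slices, and for a finite set $P\subseteq\mathbb S^d$ let $$\mathrm{disp}(P;d)=\sup\{\pi_d(B): B\in\mathcal S_d,\ B\cap P=\emptyset\}$$ be its spherical dispersion. Let $X_1,\dots,X_n$ be independent random points in $\mathbb S^d$, each with distribution $\pi_d$, and let $\mathcal P_n=\{X_1,\dots,X_n\}$. Then $\mathrm{disp}(\mathcal P_n;d)$ is an integrable random variable and $$\frac19\,\frac{\log n}{n}\ \le\ \mathbb E\big[\mathrm{disp}(\mathcal P_n;d)\big]\ \le\ \frac{64}{\log 2}\,\frac dn\,\log\!\Big(\frac{en}{32d}\Big),$$ where $\log$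 is the natural logarithm. -/

import Mathlib

open MeasureTheory ProbabilityTheory

noncomputable section

namespace SphericalDispersion

/-- The Euclidean unit sphere `𝕊^d ⊆ ℝ^{d+1}`. -/
abbrev Sph (d : ℕ) : Type :=
  Metric.sphere (0 : EuclideanSpace ℝ (Fin (d + 1))) 1

/-- The uniform distribution `π_d` on `𝕊^d`: the `d`-dimensional Hausdorff measure (for the
Euclidean metric), normalized to total mass one. -/
def uniformMeasure (d : ℕ) : Measure (Sph d) :=
  (Measure.hausdorffMeasure (d : ℝ) (Set.univ : Set (Sph d)))⁻¹ •
    Measure.hausdorffMeasure (d : ℝ)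

/-- The open spherical cap `C(x,t) = {y ∈ 𝕊^d : ⟨x,y⟩ > t}`. -/
def cap {d : ℕ} (x : Sph d) (t : ℝ) : Set (Sph d) :=
  {y | t < inner ℝ (x : EuclideanSpace ℝ (Fin (d + 1))) (y : EuclideanSpace ℝ (Fin (d + 1)))}

/-- The collection of spherical slices: intersections of two caps `C(x,t)`, `C(y,s)` with
`s, t ∈ [-1,1]`. -/
def slices (d : ℕ) : Set (Set (Sph d)) :=
  {B | ∃ x y : Sph d, ∃ t ∈ Set.Icc (-1 : ℝ) 1, ∃ s ∈ Set.Icc (-1 : ℝ) 1,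
    B = cap x t ∩ cap y s}

/-- The spherical dispersion of a point set: the supremum of the normalized surface measures of
the slices that contain no point of `P`. -/
def disp (d : ℕ) (P : Set (Sph d)) : ℝ :=
  sSup {r : ℝ | ∃ B ∈ slices d, P ∩ B = ∅ ∧ r = (uniformMeasure d).real B}

end SphericalDispersion

end

/-! Upper bound. Let `D` be the dispersion of a sample of size `n`. Then `(1 + D) ^ n` is the
supremum of `(1 + π B) ^ n` over the slices `B` missed by the sample, and `(1 + π B) ^ n` is the
mean over an independent ghost sample `Y` of `2 ^ #{i | Yᵢ ∈ B}`. Interchanging sample and ghost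
points at random, in each of the `n` pairs separately, preserves the law of the `2 n` points; the
average of the resulting weight over the `2 ^ n` interchanges is at most `1` for each `B`, and it
depends on `B` only through the indices of the points in `B`. Hence `𝔼 (1 + D) ^ n` is at most the
number of subsets that slices cut out of `2 n` points. A slice is cut out by two half-spaces, and
these shatter at most `d + 2` points by Radon's theorem, so the Sauer–Shelah lemma bounds this
number. Jensen's inequality then bounds `𝔼 D`.

Lower bound. Cut the sphere into `N ≈ 2 n / log n` parallel bands of measure `1 / N`. The events
that the sample misses a given band are pairwise negatively correlated, so by the second moment
method some band is missed with probability bounded below, and then `1 / N ≤ D`. -/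

noncomputable section

namespace SphericalDispersion

open scoped ENNReal

section Dispersion

variable {S ι : Type*} [MeasurableSpace S] {π : Measure S} {𝒮 : Set (Set S)}

/-- The event that no point of a sample `x : ι → S` lies in `B`. -/
def missed (ι : Type*) {S : Type*} (B : Set S) : Set (ι → S) :=
  Set.univ.pi fun _ => Bᶜ

lemma mem_missed_iff_disjoint {S : Type*} {B : Set S} {x : ι → S} :
    x ∈ missed ι B ↔ Disjoint (Set.range x) B := by
  simp [missed, Set.disjoint_left]

lemma missed_inter_missed {S : Type*} (A B : Set S) :
    missed ι A ∩ missed ι B = missed ι (A ∪ B) := by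
  simp only [missed, ← Set.pi_inter_distrib, Set.compl_union]

lemma measurableSet_missed [Countable ι] {B : Set S} (hB : MeasurableSet B) :
    MeasurableSet (missed ι B) :=
  .univ_pi fun _ => hB.compl

lemma measureReal_pi_missed [Fintype ι] [SigmaFinite π] (B : Set S) :
    (Measure.pi fun _ : ι => π).real (missed ι B) = π.real Bᶜ ^ Fintype.card ι := by
  simp [missed, measureReal_def]

/-- The dispersion of `P` with respect to an arbitrary family `𝒮` of test sets. It is valued in
`ℝ≥0∞`, so that the supremum needs no boundedness. -/
def dispersion (π : Measure S) (𝒮 : Set (Set S)) (P : Set S) : ℝ≥0∞ :=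
  ⨆ B ∈ {B ∈ 𝒮 | Disjoint P B}, π B

lemma measure_le_dispersion {P B : Set S} (hB : B ∈ 𝒮) (hP : Disjoint P B) :
    π B ≤ dispersion π 𝒮 P :=
  le_iSup₂ (f := fun B (_ : B ∈ {B ∈ 𝒮 | Disjoint P B}) => π B) B ⟨hB, hP⟩

lemma dispersion_le_one [IsProbabilityMeasure π] (P : Set S) : dispersion π 𝒮 P ≤ 1 :=
  iSup₂_le fun _ _ => prob_le_one

lemma dispersion_ne_top [IsProbabilityMeasure π] (P : Set S) : dispersion π 𝒮 P ≠ ∞ :=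
  ne_top_of_le_ne_top ENNReal.one_ne_top (dispersion_le_one P)

lemma dispersion_toReal_le_one [IsProbabilityMeasure π] (P : Set S) :
    (dispersion π 𝒮 P).toReal ≤ 1 :=
  ENNReal.toReal_le_of_le_ofReal zero_le_one (by simpa using dispersion_le_one P)

/-- Only countably many test sets matter: the measures of the members of `𝒮` are approximated from
inside by those of a countable subfamily. This is what makes the dispersion of a random sample
measurable. -/
def IsInnerSeparable (π : Measure S) (𝒮 : Set (Set S)) : Prop :=
  ∃ ℬ ⊆ 𝒮, ℬ.Countable ∧ π.InnerRegularWRT (· ∈ ℬ) (· ∈ 𝒮)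

lemma dispersion_eq_of_innerRegularWRT {ℬ : Set (Set S)} (hsub : ℬ ⊆ 𝒮)
    (hreg : π.InnerRegularWRT (· ∈ ℬ) (· ∈ 𝒮)) (P : Set S) :
    dispersion π 𝒮 P = dispersion π ℬ P := by
  refine le_antisymm (iSup₂_le fun A ⟨hA, hPA⟩ => le_of_forall_lt fun r hr => ?_)
    (biSup_mono fun B ⟨hB, hPB⟩ => ⟨hsub hB, hPB⟩)
  obtain ⟨B, hBA, hB, hrB⟩ := hreg hA r hr
  exact hrB.trans_le (measure_le_dispersion hB (hPA.mono_right hBA))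

lemma dispersion_range_eq_biSup_indicator (x : ι → S) :
    dispersion π 𝒮 (Set.range x) = ⨆ B ∈ 𝒮, (missed ι B).indicator (fun _ => π B) x := by
  simp only [dispersion, Set.mem_ofPred_eq, iSup_and, ← mem_missed_iff_disjoint]
  refine iSup_congr fun B => iSup_congr fun _ => ?_
  by_cases hx : x ∈ missed ι B <;> simp [hx]

lemma IsInnerSeparable.measurable_dispersion_range [Countable ι] (h𝒮 : IsInnerSeparable π 𝒮)
    (hmeas : ∀ B ∈ 𝒮, MeasurableSet B) :
    Measurable fun x : ι → S => dispersion π 𝒮 (Set.range x) := by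
  obtain ⟨ℬ, hsub, hcount, hreg⟩ := h𝒮
  simp_rw [dispersion_eq_of_innerRegularWRT hsub hreg, dispersion_range_eq_biSup_indicator]
  exact .biSup ℬ hcount fun B hB =>
    measurable_const.indicator (measurableSet_missed (hmeas B (hsub hB)))

lemma IsInnerSeparable.integrable_dispersion_range [Countable ι] [IsProbabilityMeasure π]
    (h𝒮 : IsInnerSeparable π 𝒮) (hmeas : ∀ B ∈ 𝒮, MeasurableSet B) (ρ : Measure (ι → S))
    [IsFiniteMeasure ρ] :
    Integrable (fun x => (dispersion π 𝒮 (Set.range x)).toReal) ρ := by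
  refine .of_bound (h𝒮.measurable_dispersion_range hmeas).ennreal_toReal.aestronglyMeasurable 1
    (.of_forall fun x => ?_)
  rw [Real.norm_of_nonneg ENNReal.toReal_nonneg]
  exact dispersion_toReal_le_one _

end Dispersion

section DoubleSampling

variable {S ι : Type*} [Fintype ι]

/-- The families of indices that members of `𝒮` cut out of the sample `w`. -/
def traces {κ S : Type*} (w : κ → S) (𝒮 : Set (Set S)) : Set (Set κ) :=
  (w ⁻¹' ·) '' 𝒮

lemma traces_mono {κ S : Type*} {𝒮 ℬ : Set (Set S)} (w : κ → S) (h : ℬ ⊆ 𝒮) :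
    traces w ℬ ⊆ traces w 𝒮 :=
  Set.image_mono h

/-- The weight of a pair consisting of a sample point and a ghost point: it vanishes if `B` contains
the sample point, and otherwise doubles when `B` contains the ghost point, so that averaging over
the ghost point gives `1 + π B`. -/
def pairWeight (B : Set S) (p : S × S) : ℝ≥0∞ :=
  Bᶜ.indicator 1 p.1 * (1 + B.indicator 1 p.2)

lemma pairWeight_add_pairWeight_swap_le (B : Set S) (p : S × S) :
    pairWeight B p + pairWeight B p.swap ≤ 2 := by
  by_cases h₁ : p.1 ∈ B <;> by_cases h₂ : p.2 ∈ B <;>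
    simp [pairWeight, h₁, h₂, one_add_one_eq_two]

/-- Interchange the sample point and the ghost point in the pairs of `z` marked by `σ`. -/
def swapBy (σ : ι → Bool) (z : ι → S × S) : ι → S × S :=
  fun i => bif σ i then (z i).swap else z i

lemma sum_prod_pairWeight_swapBy_le [DecidableEq ι] (B : Set S) (z : ι → S × S) :
    ∑ σ : ι → Bool, ∏ i, pairWeight B (swapBy σ z i) ≤ 2 ^ Fintype.card ι := by
  calc ∑ σ : ι → Bool, ∏ i, pairWeight B (swapBy σ z i)
      = ∏ i, ∑ b : Bool, pairWeight B (bif b then (z i).swap else z i) :=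
        (Fintype.prod_sum fun i b => pairWeight B (bif b then (z i).swap else z i)).symm
    _ = ∏ i, (pairWeight B (z i) + pairWeight B (z i).swap) := by
        simp only [Fintype.sum_bool, cond_true, cond_false, add_comm]
    _ ≤ ∏ _i : ι, 2 := Finset.prod_le_prod' fun i _ => pairWeight_add_pairWeight_swap_le B (z i)
    _ = 2 ^ Fintype.card ι := by simp

lemma sum_iSup_prod_pairWeight_swapBy_le [DecidableEq ι] (ℬ : Set (Set S)) (z : ι → S × S) :
    ∑ σ : ι → Bool, ⨆ B ∈ ℬ, ∏ i, pairWeight B (swapBy σ z i) ≤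
      2 ^ Fintype.card ι * (traces (Sum.elim (Prod.fst ∘ z) (Prod.snd ∘ z)) ℬ).ncard := by
  classical
  set w : ι ⊕ ι → S := Sum.elim (Prod.fst ∘ z) (Prod.snd ∘ z)
  set 𝒯 : Finset (Set (ι ⊕ ι)) := (Set.toFinite (traces w ℬ)).toFinset
  let weight (T : Set (ι ⊕ ι)) (σ : ι → Bool) : ℝ≥0∞ :=
    ∏ i, pairWeight T (swapBy σ (fun i => (Sum.inl i, Sum.inr i)) i)
  have weight_preimage (B : Set S) (σ : ι → Bool) :
      ∏ i, pairWeight B (swapBy σ z i) = weight (w ⁻¹' B) σ :=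
    Finset.prod_congr rfl fun i _ => by cases h : σ i <;> simp only [swapBy, h] <;> rfl
  calc ∑ σ : ι → Bool, ⨆ B ∈ ℬ, ∏ i, pairWeight B (swapBy σ z i)
      ≤ ∑ σ : ι → Bool, ∑ T ∈ 𝒯, weight T σ := by
        refine Finset.sum_le_sum fun σ _ => iSup₂_le fun B hB => ?_
        rw [weight_preimage]
        refine Finset.single_le_sum (f := (weight · σ)) (fun _ _ => zero_le) ?_
        exact (Set.Finite.mem_toFinset _).2 (Set.mem_image_of_mem _ hB)
    _ = ∑ T ∈ 𝒯, ∑ σ : ι → Bool, weight T σ := Finset.sum_comm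
    _ ≤ ∑ _T ∈ 𝒯, 2 ^ Fintype.card ι :=
        Finset.sum_le_sum fun T _ => sum_prod_pairWeight_swapBy_le T _
    _ = 2 ^ Fintype.card ι * (traces w ℬ).ncard := by
        rw [Finset.sum_const, nsmul_eq_mul, mul_comm, Set.ncard_eq_toFinset_card]

variable [MeasurableSpace S]

lemma measurable_pairWeight {B : Set S} (hB : MeasurableSet B) : Measurable (pairWeight B) := by
  unfold pairWeight
  exact ((measurable_one.indicator hB.compl).comp measurable_fst).mul
    (((measurable_one.indicator hB).comp measurable_snd).const_add 1)

lemma measurable_biSup_prod_pairWeight {ℬ : Set (Set S)} (hcount : ℬ.Countable)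
    (hmeas : ∀ B ∈ ℬ, MeasurableSet B) :
    Measurable fun z : ι → S × S => ⨆ B ∈ ℬ, ∏ i, pairWeight B (z i) :=
  .biSup ℬ hcount fun B hB => Finset.measurable_prod _ fun i _ =>
    (measurable_pairWeight (hmeas B hB)).comp (measurable_pi_apply i)

variable (π : Measure S) [IsProbabilityMeasure π]

lemma lintegral_prod_pairWeight {B : Set S} (hB : MeasurableSet B) (x : ι → S) :
    ∫⁻ y, ∏ i, pairWeight B (x i, y i) ∂(Measure.pi fun _ : ι => π) =
      (missed ι B).indicator (fun _ => (1 + π B) ^ Fintype.card ι) x := by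
  have hm (i : ι) : Measurable fun s => pairWeight B (x i, s) :=
    (measurable_pairWeight hB).comp measurable_prodMk_left
  have hfactor (i : ι) : ∫⁻ y, pairWeight B (x i, y i) ∂(Measure.pi fun _ : ι => π) =
      Bᶜ.indicator 1 (x i) * (1 + π B) := by
    rw [(measurePreserving_eval (fun _ : ι => π) i).lintegral_comp (hm i)]
    simp only [pairWeight]
    rw [lintegral_const_mul _ ((measurable_one.indicator hB).const_add 1),
      lintegral_add_left measurable_const, lintegral_indicator_one hB, lintegral_const,
      measure_univ, mul_one]
  rw [lintegral_prod_eq_prod_lintegral_of_indepFun _ _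
      (iIndepFun_pi (X := fun i s => pairWeight B (x i, s)) fun i => (hm i).aemeasurable)
      fun i => (hm i).comp (measurable_pi_apply i)]
  simp_rw [hfactor]
  rw [Finset.prod_mul_distrib, ← Set.indicator_pi_one_apply, Finset.prod_const, Finset.card_univ,
    Finset.coe_univ]
  change (missed ι B).indicator 1 x * _ = _
  by_cases hx : x ∈ missed ι B <;> simp [hx]

lemma measurePreserving_swapBy (σ : ι → Bool) :
    MeasurePreserving (swapBy (S := S) σ) (Measure.pi fun _ : ι => π.prod π)
      (Measure.pi fun _ : ι => π.prod π) := by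
  refine measurePreserving_pi (fun _ : ι => π.prod π) (fun _ => π.prod π)
    (f := fun i p => bif σ i then p.swap else p) fun i => ?_
  cases σ i
  · exact .id _
  · exact Measure.measurePreserving_swap

lemma lintegral_biSup_prod_pairWeight_le {ℬ : Set (Set S)} (hcount : ℬ.Countable)
    (hmeas : ∀ B ∈ ℬ, MeasurableSet B) {G : ℕ}
    (hG : ∀ w : ι ⊕ ι → S, (traces w ℬ).ncard ≤ G) :
    ∫⁻ z, ⨆ B ∈ ℬ, ∏ i, pairWeight B (z i) ∂(Measure.pi fun _ : ι => π.prod π) ≤ G := by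
  classical
  set ρ : Measure (ι → S × S) := Measure.pi fun _ => π.prod π
  let F : (ι → S × S) → ℝ≥0∞ := fun z => ⨆ B ∈ ℬ, ∏ i, pairWeight B (z i)
  have hF : Measurable F := measurable_biSup_prod_pairWeight hcount hmeas
  have hsymm : 2 ^ Fintype.card ι * ∫⁻ z, F z ∂ρ ≤ 2 ^ Fintype.card ι * G :=
    calc 2 ^ Fintype.card ι * ∫⁻ z, F z ∂ρ
        = ∑ σ : ι → Bool, ∫⁻ z, F (swapBy σ z) ∂ρ := by
          simp [(measurePreserving_swapBy π _).lintegral_comp hF, ρ]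
      _ = ∫⁻ z, ∑ σ : ι → Bool, F (swapBy σ z) ∂ρ :=
          (lintegral_finsetSum _ fun σ _ => hF.comp (measurePreserving_swapBy π σ).measurable).symm
      _ ≤ ∫⁻ _z, 2 ^ Fintype.card ι * G ∂ρ := lintegral_mono fun z =>
          (sum_iSup_prod_pairWeight_swapBy_le ℬ z).trans (by gcongr; exact hG _)
      _ = 2 ^ Fintype.card ι * G := by simp
  exact (ENNReal.mul_le_mul_iff_right (by simp) (by finiteness)).1 hsymm

lemma lintegral_biSup_missed_le {ℬ : Set (Set S)} (hcount : ℬ.Countable)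
    (hmeas : ∀ B ∈ ℬ, MeasurableSet B) {G : ℕ}
    (hG : ∀ w : ι ⊕ ι → S, (traces w ℬ).ncard ≤ G) :
    ∫⁻ x, ⨆ B ∈ ℬ, (missed ι B).indicator (fun _ => (1 + π B) ^ Fintype.card ι) x
      ∂(Measure.pi fun _ : ι => π) ≤ G := by
  set ρ : Measure (ι → S) := Measure.pi fun _ => π
  let F : (ι → S × S) → ℝ≥0∞ := fun z => ⨆ B ∈ ℬ, ∏ i, pairWeight B (z i)
  have hF : Measurable F := measurable_biSup_prod_pairWeight hcount hmeas
  let e := MeasurableEquiv.arrowProdEquivProdArrow S S ι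
  have he : MeasurePreserving e.symm (ρ.prod ρ) (Measure.pi fun _ => π.prod π) :=
    (measurePreserving_arrowProdEquivProdArrow S S ι (fun _ => π) (fun _ => π)).symm e
  calc ∫⁻ x, ⨆ B ∈ ℬ, (missed ι B).indicator (fun _ => (1 + π B) ^ Fintype.card ι) x ∂ρ
      ≤ ∫⁻ x, ∫⁻ y, F (e.symm (x, y)) ∂ρ ∂ρ := by
        refine lintegral_mono fun x => iSup₂_le fun B hB => ?_
        rw [← lintegral_prod_pairWeight π (hmeas B hB)]
        exact lintegral_mono fun y =>
          le_iSup₂ (f := fun B (_ : B ∈ ℬ) => ∏ i, pairWeight B (x i, y i)) B hB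
    _ = ∫⁻ p, F (e.symm p) ∂(ρ.prod ρ) :=
        (lintegral_prod _ (hF.comp e.symm.measurable).aemeasurable).symm
    _ = ∫⁻ z, F z ∂(Measure.pi fun _ => π.prod π) := he.lintegral_comp hF
    _ ≤ G := lintegral_biSup_prod_pairWeight_le π hcount hmeas hG

end DoubleSampling

section UpperBound

variable {S ι : Type*} [Fintype ι] [MeasurableSpace S] {π : Measure S} {𝒮 : Set (Set S)}

lemma one_add_dispersion_pow_eq_biSup_missed (h𝒮 : ∅ ∈ 𝒮) (x : ι → S) :
    (1 + dispersion π 𝒮 (Set.range x)) ^ Fintype.card ι =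
      ⨆ B ∈ 𝒮, (missed ι B).indicator (fun _ => (1 + π B) ^ Fintype.card ι) x := by
  have : Nonempty {B ∈ 𝒮 | Disjoint (Set.range x) B} := ⟨∅, h𝒮, Set.disjoint_empty _⟩
  rw [dispersion, iSup_subtype', ENNReal.add_iSup, ENNReal.iSup_pow, iSup_subtype]
  simp only [Set.mem_ofPred_eq, iSup_and, ← mem_missed_iff_disjoint]
  refine iSup_congr fun B => iSup_congr fun _ => ?_
  by_cases hx : x ∈ missed ι B <;> simp [hx]

variable [IsProbabilityMeasure π]

lemma IsInnerSeparable.lintegral_one_add_dispersion_pow_le (hsep : IsInnerSeparable π 𝒮)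
    (hmeas : ∀ B ∈ 𝒮, MeasurableSet B) (hempty : ∅ ∈ 𝒮) {G : ℕ}
    (hG : ∀ w : ι ⊕ ι → S, (traces w 𝒮).ncard ≤ G) :
    ∫⁻ x, (1 + dispersion π 𝒮 (Set.range x)) ^ Fintype.card ι
      ∂(Measure.pi fun _ : ι => π) ≤ G := by
  obtain ⟨ℬ, hsub, hcount, hreg⟩ := hsep
  have hsub' : insert ∅ ℬ ⊆ 𝒮 := Set.insert_subset hempty hsub
  have hreg' : π.InnerRegularWRT (· ∈ insert ∅ ℬ) (· ∈ 𝒮) := fun A hA r hr =>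
    let ⟨B, hBA, hB, hrB⟩ := hreg hA r hr
    ⟨B, hBA, Set.mem_insert_of_mem _ hB, hrB⟩
  simp_rw [dispersion_eq_of_innerRegularWRT hsub' hreg',
    one_add_dispersion_pow_eq_biSup_missed (Set.mem_insert ∅ ℬ)]
  exact lintegral_biSup_missed_le π (hcount.insert ∅) (fun B hB => hmeas B (hsub' hB)) fun w =>
    (Set.ncard_le_ncard (traces_mono w hsub')).trans (hG w)

lemma mul_log_two_le_log_one_add {t : ℝ} (h₀ : 0 ≤ t) (h₁ : t ≤ 1) :
    t * Real.log 2 ≤ Real.log (1 + t) := by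
  rw [← Real.log_rpow two_pos]
  have h := rpow_one_add_le_one_add_mul_self (s := 1) (by norm_num) h₀ h₁
  norm_num at h
  exact Real.log_le_log (by positivity) h

lemma mul_integral_le_log_of_integral_one_add_pow_le {Ω : Type*} [MeasurableSpace Ω] {μ : Measure Ω}
    [IsProbabilityMeasure μ] {X : Ω → ℝ} (hX : Measurable X) (hX₀ : ∀ ω, 0 ≤ X ω)
    (hX₁ : ∀ ω, X ω ≤ 1) {n : ℕ} {G : ℝ} (hG : ∫ ω, (1 + X ω) ^ n ∂μ ≤ G) :
    n * Real.log 2 * ∫ ω, X ω ∂μ ≤ Real.log G := by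
  have hX_int : Integrable X μ := .of_bound hX.aestronglyMeasurable 1
    (.of_forall fun ω => by simpa [abs_of_nonneg (hX₀ ω)] using hX₁ ω)
  have hpow_int : Integrable (fun ω => (1 + X ω) ^ n) μ := by
    refine .of_bound ((hX.const_add 1).pow_const n).aestronglyMeasurable (2 ^ n)
      (.of_forall fun ω => ?_)
    have h := hX₀ ω
    rw [Real.norm_of_nonneg (by positivity)]
    gcongr
    linarith [hX₁ ω]
  have hmean₀ : 0 ≤ ∫ ω, X ω ∂μ := integral_nonneg hX₀
  have hmean₁ : ∫ ω, X ω ∂μ ≤ 1 := by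
    simpa using integral_mono hX_int (integrable_const (1 : ℝ)) hX₁
  have hjensen : (1 + ∫ ω, X ω ∂μ) ^ n ≤ ∫ ω, (1 + X ω) ^ n ∂μ := by
    have h := (convexOn_pow n).map_integral_le (f := fun ω => 1 + X ω)
      (continuous_pow n).continuousOn isClosed_Ici
      (.of_forall fun ω => add_nonneg zero_le_one (hX₀ ω)) ((integrable_const 1).add hX_int)
      hpow_int
    rwa [integral_add (integrable_const 1) hX_int, integral_const, probReal_univ, one_smul] at h
  calc n * Real.log 2 * ∫ ω, X ω ∂μ
      = n * ((∫ ω, X ω ∂μ) * Real.log 2) := by ring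
    _ ≤ n * Real.log (1 + ∫ ω, X ω ∂μ) := by
        gcongr
        exact mul_log_two_le_log_one_add hmean₀ hmean₁
    _ = Real.log ((1 + ∫ ω, X ω ∂μ) ^ n) := (Real.log_pow _ _).symm
    _ ≤ Real.log G := Real.log_le_log (by positivity) (hjensen.trans hG)

theorem IsInnerSeparable.integral_dispersion_le (hsep : IsInnerSeparable π 𝒮)
    (hmeas : ∀ B ∈ 𝒮, MeasurableSet B) (hempty : ∅ ∈ 𝒮) {G : ℕ}
    (hG : ∀ w : ι ⊕ ι → S, (traces w 𝒮).ncard ≤ G) :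
    Fintype.card ι * Real.log 2 *
      ∫ x, (dispersion π 𝒮 (Set.range x)).toReal ∂(Measure.pi fun _ : ι => π) ≤ Real.log G := by
  have hD := hsep.measurable_dispersion_range (ι := ι) hmeas
  have hmoment : ∫ x, (1 + (dispersion π 𝒮 (Set.range x)).toReal) ^ Fintype.card ι
      ∂(Measure.pi fun _ : ι => π) ≤ G := by
    have hreal (x : ι → S) : (1 + (dispersion π 𝒮 (Set.range x)).toReal) ^ Fintype.card ι =
        ((1 + dispersion π 𝒮 (Set.range x)) ^ Fintype.card ι).toReal := by
      rw [ENNReal.toReal_pow, ENNReal.toReal_add ENNReal.one_ne_top (dispersion_ne_top _),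
        ENNReal.toReal_one]
    simp_rw [hreal]
    rw [integral_toReal ((hD.const_add 1).pow_const _).aemeasurable
      (.of_forall fun x => by finiteness [dispersion_ne_top (π := π) (𝒮 := 𝒮) (Set.range x)])]
    exact ENNReal.toReal_le_of_le_ofReal G.cast_nonneg
      (by simpa using hsep.lintegral_one_add_dispersion_pow_le hmeas hempty hG)
  exact mul_integral_le_log_of_integral_one_add_pow_le hD.ennreal_toReal
    (fun _ => ENNReal.toReal_nonneg) (fun _ => dispersion_toReal_le_one _) hmoment

end UpperBound

section VapnikChervonenkis

variable {κ : Type*} [Fintype κ]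

lemma ncard_le_sum_choose_of_shattered_card_le {𝒯 : Set (Set κ)} {D : ℕ}
    (h : ∀ s : Finset κ, (∀ t : Set κ, ∃ T ∈ 𝒯, ∀ j ∈ s, j ∈ T ↔ j ∈ t) → s.card ≤ D) :
    𝒯.ncard ≤ ∑ i ∈ Finset.Iic D, (Fintype.card κ).choose i := by
  classical
  set 𝒜 : Finset (Finset κ) := {T | (T : Set κ) ∈ 𝒯} with h𝒜
  have hdim : 𝒜.vcDim ≤ D := Finset.sup_le fun s hs => h s fun t => by
    obtain ⟨T, hT, hsT⟩ := Finset.mem_shatterer.1 hs (t := {j ∈ s | j ∈ t}) (s.filter_subset _)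
    refine ⟨T, by simpa [h𝒜] using hT, fun j hj => ?_⟩
    simpa [hj] using Finset.ext_iff.1 hsT j
  have hcard : 𝒯.ncard ≤ 𝒜.card := by
    have hsub : 𝒯 ⊆ (fun T : Finset κ => (T : Set κ)) '' 𝒜 := fun T hT =>
      ⟨T.toFinset, by simpa [h𝒜] using hT, T.coe_toFinset⟩
    exact (Set.ncard_le_ncard hsub).trans
      ((Set.ncard_image_le 𝒜.finite_toSet).trans_eq (Set.ncard_coe_finset 𝒜))
  calc 𝒯.ncard ≤ 𝒜.shatterer.card := hcard.trans 𝒜.card_le_card_shatterer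
    _ ≤ ∑ i ∈ Finset.Iic 𝒜.vcDim, (Fintype.card κ).choose i := Finset.card_shatterer_le_sum_vcDim
    _ ≤ ∑ i ∈ Finset.Iic D, (Fintype.card κ).choose i :=
        Finset.sum_le_sum_of_subset (Finset.Iic_subset_Iic.2 hdim)

/-- The open half-spaces of a real vector space, including the degenerate ones `∅` and the whole
space given by the zero functional. -/
def openHalfSpaces (E : Type*) [AddCommGroup E] [Module ℝ E] : Set (Set E) :=
  {H | ∃ (f : E →ₗ[ℝ] ℝ) (t : ℝ), H = {v | t < f v}}

variable {E : Type*} [AddCommGroup E] [Module ℝ E] [FiniteDimensional ℝ E]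

omit [Fintype κ] in
lemma card_le_of_shattered_by_openHalfSpaces {z : κ → E} {s : Finset κ}
    (hs : ∀ t : Set κ, ∃ H ∈ openHalfSpaces E, ∀ j ∈ s, z j ∈ H ↔ j ∈ t) :
    s.card ≤ Module.finrank ℝ E + 1 := by
  by_contra! hcard
  have hdep : ¬ AffineIndependent ℝ fun j : s => z j := fun hind => by
    have h₁ := hind.card_le_finrank_succ
    have h₂ := Submodule.finrank_le (vectorSpan ℝ (Set.range fun j : s => z j))
    rw [Fintype.card_coe] at h₁
    omega
  obtain ⟨I, p, hpI, hpIc⟩ := Convex.radon_partition hdep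
  obtain ⟨_, ⟨f, t, rfl⟩, hH⟩ := hs ((↑) '' I)
  have hmem (j : s) : t < f (z j) ↔ j ∈ I := by simpa using hH j j.2
  have hlt : p ∈ {v | t < f v} := by
    refine convexHull_min ?_ (convex_halfSpace_gt f.isLinear t) hpI
    rintro _ ⟨j, hj, rfl⟩
    exact (hmem j).2 hj
  have hle : p ∈ {v | f v ≤ t} := by
    refine convexHull_min ?_ (convex_halfSpace_le f.isLinear t) hpIc
    rintro _ ⟨j, hj, rfl⟩
    exact not_lt.1 fun hlt => hj ((hmem j).1 hlt)
  exact (show t < f p from hlt).not_ge hle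

lemma ncard_traces_openHalfSpaces_le (z : κ → E) :
    (traces z (openHalfSpaces E)).ncard ≤
      ∑ i ∈ Finset.Iic (Module.finrank ℝ E + 1), (Fintype.card κ).choose i :=
  ncard_le_sum_choose_of_shattered_card_le fun _ hs =>
    card_le_of_shattered_by_openHalfSpaces fun t =>
      let ⟨_, ⟨H, hH, hT⟩, hst⟩ := hs t
      ⟨H, hH, hT ▸ hst⟩

end VapnikChervonenkis

section Binomials

lemma sum_choose_mul_pow_le_exp (m D : ℕ) {x : ℝ} (hx₀ : 0 ≤ x) (hx₁ : x ≤ 1) :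
    (∑ i ∈ Finset.Iic D, (m.choose i : ℝ)) * x ^ D ≤ Real.exp (m * x) := by
  calc (∑ i ∈ Finset.Iic D, (m.choose i : ℝ)) * x ^ D
      ≤ ∑ i ∈ Finset.Iic D, (m.choose i : ℝ) * x ^ i := by
        rw [Finset.sum_mul]
        exact Finset.sum_le_sum fun i hi => mul_le_mul_of_nonneg_left
          (pow_le_pow_of_le_one hx₀ hx₁ (Finset.mem_Iic.1 hi)) (Nat.cast_nonneg _)
    _ ≤ ∑ i ∈ Finset.range (m + 1), (m.choose i : ℝ) * x ^ i := by
        rw [← Finset.sum_filter_of_ne (p := (· ∈ Finset.range (m + 1)))]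
        · exact Finset.sum_le_sum_of_subset_of_nonneg
            (fun i hi => (Finset.mem_filter.1 hi).2) fun i _ _ => by positivity
        · intro i _ hne
          by_contra! hi
          simp_all [Nat.choose_eq_zero_of_lt]
    _ = (x + 1) ^ m := by simp [add_pow, mul_comm]
    _ ≤ Real.exp x ^ m := by gcongr; exact Real.add_one_le_exp x
    _ = Real.exp (m * x) := (Real.exp_nat_mul x m).symm

lemma log_sum_choose_le (m D : ℕ) {x : ℝ} (hx₀ : 0 < x) (hx₁ : x ≤ 1) :
    Real.log (∑ i ∈ Finset.Iic D, (m.choose i : ℝ)) ≤ m * x - D * Real.log x := by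
  have hpos : 0 < ∑ i ∈ Finset.Iic D, (m.choose i : ℝ) :=
    Finset.sum_pos' (fun _ _ => by positivity) ⟨0, by simp, by simp⟩
  have h := Real.log_le_log (by positivity) (sum_choose_mul_pow_le_exp m D hx₀.le hx₁)
  rw [Real.log_exp, Real.log_mul hpos.ne' (by positivity), Real.log_pow] at h
  linarith

end Binomials

section Slices

variable {d : ℕ}

lemma isOpen_cap (x : Sph d) (t : ℝ) : IsOpen (cap x t) :=
  isOpen_lt continuous_const (continuous_const.inner continuous_subtype_val)

lemma measurableSet_of_mem_slices {B : Set (Sph d)} (hB : B ∈ slices d) : MeasurableSet B := by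
  obtain ⟨x, y, t, -, s, -, rfl⟩ := hB
  exact ((isOpen_cap x t).inter (isOpen_cap y s)).measurableSet

lemma inner_le_one (x y : Sph d) :
    inner ℝ (x : EuclideanSpace ℝ (Fin (d + 1))) (y : EuclideanSpace ℝ (Fin (d + 1))) ≤ 1 := by
  simpa using real_inner_le_norm (x : EuclideanSpace ℝ (Fin (d + 1))) y

lemma cap_min_one (x : Sph d) (t : ℝ) : cap x (min t 1) = cap x t := by
  ext y
  simp [cap, (inner_le_one x y).not_gt]

lemma cap_inter_cap_mem_slices (x y : Sph d) {t s : ℝ} (ht : -1 ≤ t) (hs : -1 ≤ s) :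
    cap x t ∩ cap y s ∈ slices d :=
  ⟨x, y, min t 1, ⟨le_min ht (by norm_num), min_le_right _ _⟩,
    min s 1, ⟨le_min hs (by norm_num), min_le_right _ _⟩, by rw [cap_min_one, cap_min_one]⟩

lemma empty_mem_slices (d : ℕ) : ∅ ∈ slices d := by
  obtain ⟨x⟩ : Nonempty (Sph d) := (NormedSpace.sphere_nonempty.2 zero_le_one).to_subtype
  refine ⟨x, x, 1, by simp, 1, by simp, ?_⟩
  simp [cap, (inner_le_one x _).not_gt]

lemma disp_eq_toReal_dispersion [IsFiniteMeasure (uniformMeasure d)] (P : Set (Sph d)) :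
    disp d P = (dispersion (uniformMeasure d) (slices d) P).toReal := by
  rw [disp, dispersion, ← sSup_image,
    ENNReal.toReal_sSup _ (Set.forall_mem_image.2 fun B _ => measure_ne_top _ B)]
  congr 1
  ext r
  simp [Set.disjoint_iff_inter_eq_empty, and_assoc, eq_comm, measureReal_def]

lemma ncard_traces_slices_le {κ : Type*} [Fintype κ] (w : κ → Sph d) :
    (traces w (slices d)).ncard ≤
      (∑ i ∈ Finset.Iic (d + 2), (Fintype.card κ).choose i) ^ 2 := by
  set 𝒯 := traces (fun j => (w j : EuclideanSpace ℝ (Fin (d + 1)))) (openHalfSpaces _)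
  have hsub : traces w (slices d) ⊆ Set.image2 (· ∩ ·) 𝒯 𝒯 := by
    rintro _ ⟨_, ⟨x, y, t, -, s, -, rfl⟩, rfl⟩
    have hcap (x : Sph d) (t : ℝ) : w ⁻¹' cap x t ∈ 𝒯 := ⟨_, ⟨innerₛₗ ℝ x.1, t, rfl⟩, rfl⟩
    exact ⟨_, hcap x t, _, hcap y s, rfl⟩
  have hcard : 𝒯.ncard ≤ ∑ i ∈ Finset.Iic (d + 2), (Fintype.card κ).choose i := by
    simpa only [finrank_euclideanSpace_fin] using ncard_traces_openHalfSpaces_le fun j =>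
      (w j : EuclideanSpace ℝ (Fin (d + 1)))
  calc (traces w (slices d)).ncard ≤ (Set.image2 (· ∩ ·) 𝒯 𝒯).ncard := Set.ncard_le_ncard hsub
    _ ≤ 𝒯.ncard * 𝒯.ncard := by
        rw [← Set.image_prod, ← Set.ncard_prod]
        exact Set.ncard_image_le
    _ ≤ _ := by rw [sq]; gcongr

lemma log_sq_sum_choose_le {n : ℕ} (hd : 1 ≤ d) (hn : 32 * d ≤ n) :
    Real.log (((∑ i ∈ Finset.Iic (d + 2), (2 * n).choose i) ^ 2 : ℕ) : ℝ) ≤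
      64 * d * Real.log (Real.exp 1 * n / (32 * d)) := by
  have hd' : (1 : ℝ) ≤ d := by exact_mod_cast hd
  have hn' : 32 * (d : ℝ) ≤ n := by exact_mod_cast hn
  have hn₀ : (0 : ℝ) < n := by linarith
  set L := Real.log (n / (32 * d))
  have hL₀ : 0 ≤ L := Real.log_nonneg (by rw [le_div_iff₀ (by positivity)]; linarith)
  have hlogx : Real.log (4 * d / n) = -(3 * Real.log 2 + L) := by
    have hx : 4 * (d : ℝ) / n = (2 ^ 3 * ((n : ℝ) / (32 * d)))⁻¹ := by field_simp; norm_num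
    rw [hx, Real.log_inv, Real.log_mul (by norm_num) (by positivity), Real.log_pow, Nat.cast_ofNat]
  have hlogsum := log_sum_choose_le (2 * n) (d + 2) (x := 4 * d / n) (by positivity)
    ((div_le_one hn₀).2 (by linarith))
  have hmx : ((2 * n : ℕ) : ℝ) * (4 * d / n) = 8 * d := by push_cast; field_simp; norm_num
  rw [hmx, hlogx] at hlogsum
  push_cast at hlogsum ⊢
  rw [Real.log_pow, mul_div_assoc, Real.log_mul (Real.exp_pos 1).ne' (by positivity), Real.log_exp]
  have hD : ((d : ℝ) + 2) * (3 * Real.log 2 + L) ≤ 3 * d * (3 + L) := by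
    gcongr <;> linarith [Real.log_two_lt_d9]
  push_cast
  nlinarith [mul_nonneg (zero_le_one.trans hd') hL₀]

lemma exists_countable_caps (d : ℕ) : ∃ 𝒞 : Set (Set (Sph d)), 𝒞.Countable ∧
    (∀ C ∈ 𝒞, ∃ x, ∃ t ≥ -1, C = cap x t) ∧
    ∀ x, ∀ t ≥ -1, ∀ δ > 0, ∃ C ∈ 𝒞, cap x (t + δ) ⊆ C ∧ C ⊆ cap x t := by
  obtain ⟨Z, hZ, hZd⟩ := TopologicalSpace.exists_countable_dense (Sph d)
  refine ⟨Set.image2 (fun z (q : ℚ) => cap z q) Z {q | (-1 : ℝ) ≤ q},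
    hZ.image2 (Set.to_countable _) _, ?_, fun x t ht δ hδ => ?_⟩
  · rintro _ ⟨z, -, q, hq, rfl⟩
    exact ⟨z, q, hq, rfl⟩
  obtain ⟨z, hzZ, hz⟩ := hZd.exists_dist_lt x (show 0 < δ / 3 by positivity)
  obtain ⟨q, hq₁, hq₂⟩ := exists_rat_btwn (show t + δ / 3 < t + 2 * δ / 3 by linarith)
  have hinner (y : Sph d) : |inner ℝ x.1 y.1 - inner ℝ z.1 y.1| < δ / 3 := by
    rw [← inner_sub_left]
    refine (abs_real_inner_le_norm _ _).trans_lt ?_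
    rwa [norm_eq_of_mem_sphere y, mul_one, ← dist_eq_norm]
  refine ⟨cap z q, ⟨z, hzZ, q, by simp only [Set.mem_ofPred_eq]; linarith, rfl⟩,
    fun y hy => ?_, fun y hy => ?_⟩
  all_goals
    have := abs_lt.1 (hinner y)
    simp only [cap, Set.mem_ofPred_eq] at hy ⊢
    linarith

lemma iUnion_cap_add_inter_cap_add (x y : Sph d) (t s : ℝ) :
    ⋃ m : ℕ, cap x (t + 1 / (m + 1)) ∩ cap y (s + 1 / (m + 1)) = cap x t ∩ cap y s := by
  ext v
  simp only [cap, Set.mem_iUnion, Set.mem_inter_iff, Set.mem_ofPred_eq]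
  refine ⟨fun ⟨m, h₁, h₂⟩ => ?_, fun ⟨h₁, h₂⟩ => ?_⟩
  · have := Nat.one_div_pos_of_nat (α := ℝ) (n := m)
    constructor <;> linarith
  · obtain ⟨m, hm⟩ := exists_nat_one_div_lt (lt_min (sub_pos.2 h₁) (sub_pos.2 h₂))
    rw [lt_min_iff] at hm
    exact ⟨m, by linarith [hm.1], by linarith [hm.2]⟩

lemma isInnerSeparable_slices (π : Measure (Sph d)) : IsInnerSeparable π (slices d) := by
  obtain ⟨𝒞, hcount, hcap, happrox⟩ := exists_countable_caps d
  refine ⟨Set.image2 (· ∩ ·) 𝒞 𝒞, ?_, hcount.image2 hcount _, ?_⟩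
  · rintro _ ⟨A, hA, B, hB, rfl⟩
    obtain ⟨x, t, ht, rfl⟩ := hcap A hA
    obtain ⟨y, s, hs, rfl⟩ := hcap B hB
    exact cap_inter_cap_mem_slices x y ht hs
  rintro _ ⟨x, y, t, ht, s, hs, rfl⟩ r hr
  have hmono : Monotone fun m : ℕ =>
      cap x (t + 1 / ((m : ℝ) + 1)) ∩ cap y (s + 1 / ((m : ℝ) + 1)) := by
    intro m m' hm v ⟨hx, hy⟩
    have := Nat.one_div_le_one_div (α := ℝ) hm
    constructor <;> simp only [cap, Set.mem_ofPred_eq] at hx hy ⊢ <;> linarith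
  rw [← iUnion_cap_add_inter_cap_add, hmono.measure_iUnion] at hr
  obtain ⟨m, hm⟩ := lt_iSup_iff.1 hr
  have hm₀ := Nat.one_div_pos_of_nat (α := ℝ) (n := m)
  obtain ⟨A, hA, hAx, hAt⟩ := happrox x t ht.1 _ hm₀
  obtain ⟨B, hB, hBy, hBs⟩ := happrox y s hs.1 _ hm₀
  exact ⟨A ∩ B, Set.inter_subset_inter hAt hBs, ⟨A, hA, B, hB, rfl⟩,
    hm.trans_le (measure_mono (Set.inter_subset_inter hAx hBy))⟩

theorem integral_disp_le {n : ℕ} [IsProbabilityMeasure (uniformMeasure d)] (hd : 1 ≤ d)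
    (hn : 32 * d ≤ n) :
    ∫ x : Fin n → Sph d, disp d (Set.range x) ∂(Measure.pi fun _ => uniformMeasure d) ≤
      64 / Real.log 2 * ((d : ℝ) / n) * Real.log (Real.exp 1 * n / (32 * d)) := by
  have hn₀ : (0 : ℝ) < n := by exact_mod_cast (by omega : 0 < n)
  have hgrowth (w : Fin n ⊕ Fin n → Sph d) :
      (traces w (slices d)).ncard ≤ (∑ i ∈ Finset.Iic (d + 2), (2 * n).choose i) ^ 2 := by
    simpa [two_mul] using ncard_traces_slices_le w
  have h := (isInnerSeparable_slices (uniformMeasure d)).integral_dispersion_le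
    (fun _ => measurableSet_of_mem_slices) (empty_mem_slices d) hgrowth
  simp_rw [disp_eq_toReal_dispersion]
  rw [Fintype.card_fin] at h
  calc _ ≤ (64 * d * Real.log (Real.exp 1 * n / (32 * d))) / (n * Real.log 2) :=
        (le_div_iff₀' (by positivity)).2 (h.trans (log_sq_sum_choose_le hd hn))
    _ = _ := by field_simp

end Slices

section SecondMoment

variable {Ω : Type*} [MeasurableSpace Ω] (μ : Measure Ω) [IsFiniteMeasure μ]

variable {μ} in
lemma sq_integral_le_measureReal_mul_integral_sq {Z : Ω → ℝ} (hZ : Integrable Z μ)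
    (hZsq : Integrable (fun ω => Z ω ^ 2) μ) {U : Set Ω} (hU : MeasurableSet U)
    (hZU : ∀ ω ∉ U, Z ω = 0) :
    (∫ ω, Z ω ∂μ) ^ 2 ≤ μ.real U * ∫ ω, Z ω ^ 2 ∂μ := by
  let I : Ω → ℝ := U.indicator 1
  have hI : Integrable I μ := (integrable_const 1).indicator hU
  have hexpand (c : ℝ) (ω : Ω) : (c * I ω - Z ω) ^ 2 = c ^ 2 * I ω - 2 * c * Z ω + Z ω ^ 2 := by
    by_cases hω : ω ∈ U
    · rw [show I ω = 1 from Set.indicator_of_mem hω 1]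
      ring
    · simp [hZU ω hω, show I ω = 0 from Set.indicator_of_notMem hω 1]
  have hquadratic (c : ℝ) :
      0 ≤ μ.real U * (c * c) + -2 * (∫ ω, Z ω ∂μ) * c + ∫ ω, Z ω ^ 2 ∂μ := by
    have h : 0 ≤ ∫ ω, (c * I ω - Z ω) ^ 2 ∂μ := integral_nonneg fun _ => sq_nonneg _
    have hlin : Integrable (fun ω => c ^ 2 * I ω - 2 * c * Z ω) μ :=
      (hI.const_mul _).sub (hZ.const_mul _)
    simp_rw [hexpand] at h
    rw [integral_add hlin hZsq, integral_sub (hI.const_mul _) (hZ.const_mul _),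
      integral_const_mul, integral_const_mul, integral_indicator_one hU] at h
    linarith
  have hdiscrim := discrim_le_zero hquadratic
  rw [discrim] at hdiscrim
  linarith

variable {κ : Type*} [Fintype κ] {A : κ → Set Ω} (hA : ∀ i, MeasurableSet (A i))
include hA

/-- The Chung–Erdős inequality. -/
lemma sq_sum_measureReal_le_measureReal_iUnion_mul :
    (∑ i, μ.real (A i)) ^ 2 ≤ μ.real (⋃ i, A i) * ∑ i, ∑ j, μ.real (A i ∩ A j) := by
  let count (ω : Ω) : ℝ := ∑ i, (A i).indicator 1 ω
  have hind (i : κ) : Integrable ((A i).indicator (1 : Ω → ℝ)) μ :=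
    (integrable_const 1).indicator (hA i)
  have hpair (i j : κ) : Integrable ((A i ∩ A j).indicator (1 : Ω → ℝ)) μ :=
    (integrable_const 1).indicator ((hA i).inter (hA j))
  have hpairs (i : κ) : Integrable (fun ω => ∑ j, (A i ∩ A j).indicator (1 : Ω → ℝ) ω) μ :=
    integrable_finsetSum _ fun j _ => hpair i j
  have hcount_sq : (fun ω => count ω ^ 2) =
      fun ω => ∑ i, ∑ j, (A i ∩ A j).indicator (1 : Ω → ℝ) ω := by
    funext ω
    simp only [count, sq, Finset.sum_mul_sum, Set.inter_indicator_one, Pi.mul_apply]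
  have hmean : ∫ ω, count ω ∂μ = ∑ i, μ.real (A i) := by
    simp_rw [count, integral_finsetSum _ fun i _ => hind i, integral_indicator_one (hA _)]
  have hmoment : ∫ ω, count ω ^ 2 ∂μ = ∑ i, ∑ j, μ.real (A i ∩ A j) := by
    simp_rw [hcount_sq, integral_finsetSum _ fun i _ => hpairs i,
      integral_finsetSum _ fun j _ => hpair _ j, integral_indicator_one ((hA _).inter (hA _))]
  have hcount_sq_int : Integrable (fun ω => count ω ^ 2) μ :=
    hcount_sq ▸ integrable_finsetSum _ fun i _ => hpairs i
  rw [← hmean, ← hmoment]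
  refine sq_integral_le_measureReal_mul_integral_sq (integrable_finsetSum _ fun i _ => hind i)
    hcount_sq_int (.iUnion hA) fun ω hω => Finset.sum_eq_zero fun i _ => ?_
  exact Set.indicator_of_notMem (fun h => hω (Set.mem_iUnion_of_mem i h)) 1

lemma div_one_add_le_measureReal_iUnion {q : ℝ} (hq : ∀ i, μ.real (A i) = q)
    (hpair : Pairwise fun i j => μ.real (A i ∩ A j) ≤ q ^ 2) :
    Fintype.card κ * q / (1 + Fintype.card κ * q) ≤ μ.real (⋃ i, A i) := by
  classical
  cases isEmpty_or_nonempty κ with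
  | inl h => simp
  | inr h =>
  have hq₀ : 0 ≤ q := hq (Classical.arbitrary κ) ▸ measureReal_nonneg
  set m : ℝ := Fintype.card κ * q with hm
  have hm₀ : 0 ≤ m := by positivity
  have hpairs : ∑ i, ∑ j, μ.real (A i ∩ A j) ≤ m + m ^ 2 :=
    calc ∑ i, ∑ j, μ.real (A i ∩ A j)
        ≤ ∑ i : κ, ∑ j : κ, ((if i = j then q else 0) + q ^ 2) := by
          gcongr with i _ j
          split_ifs with hij
          · rw [hij, Set.inter_self, hq]
            nlinarith
          · simpa using hpair hij
      _ = m + m ^ 2 := by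
          simp [Finset.sum_add_distrib, hm]
          ring
  have hsq : m ^ 2 ≤ μ.real (⋃ i, A i) * (m + m ^ 2) := by
    have h := sq_sum_measureReal_le_measureReal_iUnion_mul μ hA
    simp only [hq, Finset.sum_const, Finset.card_univ, nsmul_eq_mul, ← hm] at h
    exact h.trans (by gcongr)
  rw [div_le_iff₀ (by positivity)]
  rcases hm₀.eq_or_lt with hm' | hm'
  · rw [← hm']
    positivity
  · nlinarith

end SecondMoment

section LowerBound

variable {S ι κ : Type*} [Fintype ι] [Fintype κ] [MeasurableSpace S] {π : Measure S}
  [IsProbabilityMeasure π] {A : κ → Set S} {p : ℝ}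

lemma div_one_add_le_measureReal_iUnion_missed (hA : ∀ j, MeasurableSet (A j))
    (hp : ∀ j, π.real (A j) = p) (hdisj : Pairwise (Function.onFun Disjoint A)) :
    Fintype.card κ * (1 - p) ^ Fintype.card ι / (1 + Fintype.card κ * (1 - p) ^ Fintype.card ι) ≤
      (Measure.pi fun _ : ι => π).real (⋃ j, missed ι (A j)) := by
  refine div_one_add_le_measureReal_iUnion _ (fun j => measurableSet_missed (hA j))
    (fun j => ?_) fun i j hij => ?_
  · rw [measureReal_pi_missed, probReal_compl_eq_one_sub (hA j), hp]
  · have hcompl : π.real (A i ∪ A j)ᶜ = 1 - 2 * p := by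
      rw [probReal_compl_eq_one_sub ((hA i).union (hA j)), measureReal_union (hdisj hij) (hA j),
        hp, hp, two_mul]
    have h₀ : 0 ≤ 1 - 2 * p := hcompl ▸ measureReal_nonneg
    change (Measure.pi fun _ : ι => π).real (missed ι (A i) ∩ missed ι (A j)) ≤ _
    rw [missed_inter_missed, measureReal_pi_missed, hcompl, ← pow_mul, mul_comm _ 2, pow_mul]
    gcongr
    nlinarith [sq_nonneg p]

theorem IsInnerSeparable.le_integral_dispersion {𝒮 : Set (Set S)} (hsep : IsInnerSeparable π 𝒮)
    (hmeas : ∀ B ∈ 𝒮, MeasurableSet B) (hA : ∀ j, A j ∈ 𝒮) (hp₀ : 0 ≤ p)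
    (hp : ∀ j, π.real (A j) = p) (hdisj : Pairwise (Function.onFun Disjoint A)) :
    p * (Fintype.card κ * (1 - p) ^ Fintype.card ι /
        (1 + Fintype.card κ * (1 - p) ^ Fintype.card ι)) ≤
      ∫ x, (dispersion π 𝒮 (Set.range x)).toReal ∂(Measure.pi fun _ : ι => π) := by
  have hmissed : ⋃ j, missed ι (A j) ⊆ {x | p ≤ (dispersion π 𝒮 (Set.range x)).toReal} :=
    Set.iUnion_subset fun j x hx => hp j ▸ ENNReal.toReal_mono (dispersion_ne_top _)
      (measure_le_dispersion (hA j) (mem_missed_iff_disjoint.1 hx))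
  calc _ ≤ p * (Measure.pi fun _ : ι => π).real (⋃ j, missed ι (A j)) := by
        gcongr
        exact div_one_add_le_measureReal_iUnion_missed (fun j => hmeas _ (hA j)) hp hdisj
    _ ≤ p * (Measure.pi fun _ : ι => π).real
          {x | p ≤ (dispersion π 𝒮 (Set.range x)).toReal} := by
        gcongr
        finiteness
    _ ≤ _ := mul_meas_ge_le_integral_of_nonneg (.of_forall fun _ => ENNReal.toReal_nonneg)
        (hsep.integrable_dispersion_range hmeas _) p

end LowerBound

section Quantiles

variable (ν : Measure ℝ) [IsProbabilityMeasure ν] [NullSingletonClass ν]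

lemma continuous_cdf : Continuous (cdf ν) := by
  refine continuous_iff_continuousAt.2 fun t => ?_
  have hmono := monotone_cdf ν
  rw [hmono.continuousAt_iff_leftLim_eq_rightLim, (cdf ν).rightLim_eq]
  have hjump := (cdf ν).measure_singleton t
  rw [measure_cdf, measure_singleton, eq_comm, ENNReal.ofReal_eq_zero] at hjump
  exact le_antisymm (hmono.leftLim_le le_rfl) (by linarith)

lemma measureReal_Ioo_eq_cdf_sub {s t : ℝ} (hst : s ≤ t) :
    ν.real (Set.Ioo s t) = cdf ν t - cdf ν s := by
  have h := (cdf ν).measure_Ioc s t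
  rw [measure_cdf] at h
  rw [measureReal_congr Ioo_ae_eq_Ioc, measureReal_def, h,
    ENNReal.toReal_ofReal (sub_nonneg.2 (monotone_cdf ν hst))]

variable {ν} {a b : ℝ} (hν : ∀ᵐ x ∂ν, x ∈ Set.Icc a b)
include hν

lemma exists_cdf_eq {p : ℝ} (hp : p ∈ Set.Icc (0 : ℝ) 1) : ∃ t ∈ Set.Icc a b, cdf ν t = p := by
  have ha : cdf ν a = 0 := by
    rw [cdf_eq_real, measureReal_eq_zero_iff]
    refine measure_mono_null_ae ?_ (measure_singleton a)
    filter_upwards [hν] with x hx hxa using le_antisymm hxa hx.1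
  have hb : cdf ν b = 1 := by
    rw [cdf_eq_real, ← probReal_univ (μ := ν)]
    refine measureReal_congr (Filter.eventuallyEq_univ.2 ?_)
    filter_upwards [hν] with x hx using hx.2
  obtain ⟨x, hx⟩ := hν.exists
  rw [← ha, ← hb] at hp
  exact intermediate_value_Icc (hx.1.trans hx.2) (continuous_cdf ν).continuousOn hp

lemma exists_monotone_measureReal_Ioo_eq {N : ℕ} (hN : 0 < N) :
    ∃ t : ℕ → ℝ, Monotone t ∧ (∀ j, t j ∈ Set.Icc a b) ∧
      ∀ j < N, ν.real (Set.Ioo (t j) (t (j + 1))) = 1 / N := by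
  have hN' : (0 : ℝ) < N := Nat.cast_pos.2 hN
  choose! q hq hcdf using fun p : ℝ => exists_cdf_eq (p := p) hν
  have hmono : MonotoneOn q (Set.Icc 0 1) := by
    refine StrictMonoOn.monotoneOn fun p hp p' hp' hlt => (monotone_cdf ν).reflect_lt ?_
    rwa [hcdf p hp, hcdf p' hp']
  let level (j : ℕ) : ℝ := min (j / N) 1
  have hlevel (j : ℕ) : level j ∈ Set.Icc (0 : ℝ) 1 :=
    ⟨le_min (by positivity) zero_le_one, min_le_right _ _⟩
  have hlevel_mono : Monotone level := fun i j hij => by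
    simp only [level]
    gcongr
  have hlevel_eq {j : ℕ} (hj : j ≤ N) : level j = j / N :=
    min_eq_left ((div_le_one hN').2 (Nat.cast_le.2 hj))
  have ht : Monotone fun j => q (level j) := fun i j hij =>
    hmono (hlevel i) (hlevel j) (hlevel_mono hij)
  refine ⟨fun j => q (level j), ht, fun j => hq _ (hlevel j), fun j hj => ?_⟩
  rw [measureReal_Ioo_eq_cdf_sub ν (ht j.le_succ), hcdf _ (hlevel _), hcdf _ (hlevel _),
    hlevel_eq hj, hlevel_eq hj.le, Nat.cast_succ]
  ring

end Quantiles

section Bands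

variable {d : ℕ}

lemma isometry_toLp_cons (t : ℝ) : Isometry fun w : EuclideanSpace ℝ (Fin d) =>
    (WithLp.toLp 2 (Fin.cons t w) : EuclideanSpace ℝ (Fin (d + 1))) :=
  Isometry.of_dist_eq fun v w => by simp [EuclideanSpace.dist_eq, Fin.sum_univ_succ]

lemma coe_image_coord_eq_subset (t : ℝ) :
    ((↑) : Sph d → EuclideanSpace ℝ (Fin (d + 1))) '' {y | y.1 0 = t} ⊆
      (fun w : EuclideanSpace ℝ (Fin d) => WithLp.toLp 2 (Fin.cons t w)) ''
        Metric.sphere 0 √(1 - t ^ 2) := by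
  rintro _ ⟨y, rfl, rfl⟩
  refine ⟨WithLp.toLp 2 (Fin.tail y.1), ?_, ?_⟩
  · have hnorm : ‖y.1‖ ^ 2 = 1 := by rw [norm_eq_of_mem_sphere, one_pow]
    rw [EuclideanSpace.real_norm_sq_eq, Fin.sum_univ_succ] at hnorm
    rw [mem_sphere_zero_iff_norm, EuclideanSpace.norm_eq, ← eq_sub_of_add_eq' hnorm]
    simp [Fin.tail]
  · exact congrArg (WithLp.toLp 2) (Fin.cons_self_tail _)

lemma hausdorffMeasure_sphere (hd : 1 ≤ d) (x : EuclideanSpace ℝ (Fin d)) (r : ℝ) :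
    Measure.hausdorffMeasure (d : ℝ) (Metric.sphere x r) = 0 := by
  have : Nonempty (Fin d) := ⟨⟨0, hd⟩⟩
  have : Measure.IsAddHaarMeasure
      (Measure.hausdorffMeasure (d : ℝ) : Measure (EuclideanSpace ℝ (Fin d))) := by
    simpa only [finrank_euclideanSpace_fin] using
      isAddHaarMeasure_hausdorffMeasure (E := EuclideanSpace ℝ (Fin d))
  exact Measure.addHaar_sphere _ x r

lemma uniformMeasure_coord_eq (hd : 1 ≤ d) (t : ℝ) :
    uniformMeasure d {y | y.1 0 = t} = 0 := by
  have hdim : (0 : ℝ) ≤ d ∨ Function.Surjective ((↑) : Sph d → EuclideanSpace ℝ (Fin (d + 1))) :=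
    .inl d.cast_nonneg
  have hnull : Measure.hausdorffMeasure (d : ℝ) {y : Sph d | y.1 0 = t} = 0 := by
    rw [← isometry_subtype_coe.hausdorffMeasure_image hdim]
    refine measure_mono_null (coe_image_coord_eq_subset t) ?_
    rw [(isometry_toLp_cons t).hausdorffMeasure_image (.inl d.cast_nonneg),
      hausdorffMeasure_sphere hd]
  rw [uniformMeasure, Measure.smul_apply, hnull, smul_zero]

lemma band_mem_slices {s t : ℝ} (hs : s ∈ Set.Icc (-1 : ℝ) 1) (ht : t ∈ Set.Icc (-1 : ℝ) 1) :
    {y : Sph d | y.1 0 ∈ Set.Ioo s t} ∈ slices d := by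
  let pole : Sph d := ⟨EuclideanSpace.single 0 1, by simp⟩
  refine ⟨pole, -pole, s, hs, -t, ⟨neg_le_neg ht.2, neg_le.1 ht.1⟩, ?_⟩
  ext y
  simp [cap, pole, EuclideanSpace.inner_single_left]

lemma exists_disjoint_slices [IsProbabilityMeasure (uniformMeasure d)] (hd : 1 ≤ d)
    {N : ℕ} (hN : 0 < N) :
    ∃ A : Fin N → Set (Sph d), (∀ j, A j ∈ slices d) ∧
      (∀ j, (uniformMeasure d).real (A j) = 1 / N) ∧ Pairwise (Function.onFun Disjoint A) := by
  let height (y : Sph d) : ℝ := y.1 0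
  have hheight : Measurable height := by fun_prop
  let ν := (uniformMeasure d).map height
  have : IsProbabilityMeasure ν := Measure.isProbabilityMeasure_map hheight.aemeasurable
  have : NullSingletonClass ν := ⟨fun t => by
    rw [Measure.map_apply hheight (measurableSet_singleton t)]
    exact uniformMeasure_coord_eq hd t⟩
  have hbound : ∀ᵐ x ∂ν, x ∈ Set.Icc (-1 : ℝ) 1 := by
    refine (ae_map_iff hheight.aemeasurable measurableSet_Icc).2 (.of_forall fun y => abs_le.1 ?_)
    simpa [norm_eq_of_mem_sphere] using PiLp.norm_apply_le y.1 0
  obtain ⟨t, ht_mono, ht, hmeas⟩ := exists_monotone_measureReal_Ioo_eq hbound hN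
  refine ⟨fun j => height ⁻¹' Set.Ioo (t j) (t (j + 1)), fun j => band_mem_slices (ht _) (ht _),
    fun j => ?_, fun i j hij => ?_⟩
  · rw [← map_measureReal_apply hheight measurableSet_Ioo, hmeas j j.2]
  · exact (ht_mono.pairwise_disjoint_on_Ioo_succ (Fin.val_ne_of_ne hij)).preimage height

end Bands

section NumberOfBands

lemma four_mul_log_le {x : ℝ} (hx : 32 ≤ x) : 4 * Real.log x ≤ x := by
  have hsplit : Real.log x = 5 * Real.log 2 + Real.log (x / 32) := by
    rw [Real.log_div (by positivity) (by norm_num), show (32 : ℝ) = 2 ^ 5 by norm_num,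
      Real.log_pow]
    push_cast
    ring
  have hlog := Real.log_le_sub_one_of_pos (show 0 < x / 32 by positivity)
  linarith [Real.log_two_lt_d9]

lemma exp_neg_one_div_sub_one_le {x : ℝ} (hx : 1 < x) :
    Real.exp (-(1 / (x - 1))) ≤ 1 - 1 / x := by
  have hx₁ : 0 < x - 1 := sub_pos.2 hx
  rw [show 1 - 1 / x = (1 / (x - 1) + 1)⁻¹ by field_simp; ring, Real.exp_neg]
  gcongr
  exact Real.add_one_le_exp _

lemma half_le_mul_one_sub_pow {n : ℕ} {N : ℝ} (hn : 1 < n)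
    (hN : 3 / 2 * (n / Real.log n) ≤ N - 1) : 1 / 2 ≤ N * (1 - 1 / N) ^ n := by
  have hn₀ : (0 : ℝ) < n := by exact_mod_cast hn.le
  set L := Real.log n with hL
  have hL₀ : 0 < L := Real.log_pos (by exact_mod_cast hn)
  have hN₁ : 0 < N - 1 := hN.trans_lt' (by positivity)
  have hN₀ : 0 < N := by linarith
  have hpow : Real.exp (-(2 / 3 * L)) ≤ (1 - 1 / N) ^ n :=
    calc Real.exp (-(2 / 3 * L)) ≤ Real.exp (n * -(1 / (N - 1))) := by
          gcongr
          rw [mul_neg, neg_le_neg_iff, mul_one_div, div_le_iff₀ hN₁]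
          calc (n : ℝ) = 2 / 3 * L * (3 / 2 * (n / L)) := by field_simp
            _ ≤ 2 / 3 * L * (N - 1) := by gcongr
      _ ≤ (1 - 1 / N) ^ n := by
          rw [Real.exp_nat_mul]
          gcongr
          exact exp_neg_one_div_sub_one_le (sub_pos.1 hN₁)
  have hexp : 1 / 3 * L ≤ Real.exp (1 / 3 * L) := by linarith [Real.add_one_le_exp (1 / 3 * L)]
  have hn_mul : n * Real.exp (-(2 / 3 * L)) = Real.exp (1 / 3 * L) := by
    nth_rw 1 [← Real.exp_log hn₀, ← Real.exp_add, ← hL]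
    ring_nf
  calc 1 / 2 = 3 / 2 * (1 / 3 * L / L) := by field_simp
    _ ≤ 3 / 2 * (n * Real.exp (-(2 / 3 * L)) / L) := by rw [hn_mul]; gcongr
    _ = 3 / 2 * (n / L) * Real.exp (-(2 / 3 * L)) := by ring
    _ ≤ N * (1 - 1 / N) ^ n := by
        gcongr
        linarith

lemma exists_log_div_le {n : ℕ} (hn : 32 ≤ n) : ∃ N : ℕ, 0 < N ∧
    1 / 9 * (Real.log n / n) ≤
      1 / N * (N * (1 - 1 / N) ^ n / (1 + N * (1 - 1 / N : ℝ) ^ n)) := by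
  have hn' : (32 : ℝ) ≤ n := by exact_mod_cast hn
  set L := Real.log n
  have hL₀ : 0 < L := Real.log_pos (by linarith)
  have hratio : 4 ≤ n / L := (le_div_iff₀ hL₀).2 (four_mul_log_le hn')
  set N := ⌊2 * (n / L)⌋₊
  have hN_le : (N : ℝ) ≤ 2 * (n / L) := Nat.floor_le (by positivity)
  have hN_gt : 2 * (n / L) - 1 < N := Nat.sub_one_lt_floor _
  have hN₀ : (0 : ℝ) < N := by linarith
  have hmean : 1 / 2 ≤ N * (1 - 1 / N : ℝ) ^ n :=
    half_le_mul_one_sub_pow (by omega) (by linarith)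
  refine ⟨N, Nat.cast_pos.1 hN₀, ?_⟩
  have hfrac : 2 / 9 ≤ N * (1 - 1 / N : ℝ) ^ n / (1 + N * (1 - 1 / N : ℝ) ^ n) := by
    rw [le_div_iff₀ (by linarith)]
    linarith
  calc 1 / 9 * (L / n) = 1 / (2 * (n / L)) * (2 / 9) := by field_simp
    _ ≤ _ := by gcongr

end NumberOfBands

theorem le_integral_disp {n d : ℕ} [IsProbabilityMeasure (uniformMeasure d)] (hd : 1 ≤ d)
    (hn : 32 ≤ n) :
    1 / 9 * (Real.log n / n) ≤
      ∫ x : Fin n → Sph d, disp d (Set.range x) ∂(Measure.pi fun _ => uniformMeasure d) := by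
  obtain ⟨N, hN, hle⟩ := exists_log_div_le hn
  obtain ⟨A, hA, hmeas, hdisj⟩ := exists_disjoint_slices hd hN
  have h := (isInnerSeparable_slices (uniformMeasure d)).le_integral_dispersion (ι := Fin n)
    (fun _ => measurableSet_of_mem_slices) hA (by positivity) hmeas hdisj
  simp_rw [disp_eq_toReal_dispersion]
  rw [Fintype.card_fin, Fintype.card_fin] at h
  exact hle.trans h

lemma integrable_disp_range {ι : Type*} [Fintype ι] {d : ℕ}
    [IsProbabilityMeasure (uniformMeasure d)] :
    Integrable (fun x : ι → Sph d => disp d (Set.range x))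
      (Measure.pi fun _ => uniformMeasure d) := by
  simp_rw [disp_eq_toReal_dispersion]
  exact (isInnerSeparable_slices _).integrable_dispersion_range
    (fun _ => measurableSet_of_mem_slices) _

end SphericalDispersion

end

theorem theoremB {Ω : Type*} [MeasurableSpace Ω] (μ : Measure Ω) [IsProbabilityMeasure μ]
    (n d : ℕ) (hd : 1 ≤ d) (hn : 32 * d ≤ n)
    (X : Fin n → Ω → SphericalDispersion.Sph d)
    (hlaw : ∀ i, HasLaw (X i) (SphericalDispersion.uniformMeasure d) μ)
    (hindep : iIndepFun X μ) :
    Integrable (fun ω => SphericalDispersion.disp d (Set.range fun i => X i ω)) μ ∧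
      1 / 9 * (Real.log n / n) ≤
        ∫ ω, SphericalDispersion.disp d (Set.range fun i => X i ω) ∂μ ∧
      ∫ ω, SphericalDispersion.disp d (Set.range fun i => X i ω) ∂μ ≤
        64 / Real.log 2 * ((d : ℝ) / n) * Real.log (Real.exp 1 * n / (32 * d)) := by
  have : IsProbabilityMeasure (SphericalDispersion.uniformMeasure d) :=
    (hlaw ⟨0, by omega⟩).isProbabilityMeasure_iff.1 inferInstance
  have hX := hindep.hasLaw_pi hlaw
  have hint := SphericalDispersion.integrable_disp_range (ι := Fin n) (d := d)
  have heq := hX.integral_comp hint.aestronglyMeasurable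
  refine ⟨?_, ?_, ?_⟩
  · rw [← hX.map_eq] at hint
    exact hint.comp_aemeasurable hX.aemeasurable
  · exact (SphericalDispersion.le_integral_disp hd (by omega)).trans_eq heq.symm
  · exact heq.trans_le (SphericalDispersion.integral_disp_le hd hn)
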